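/- Alphabets are finite sets; a language over $A$ is a subset of $A^*$ (finite words, including the empty word $\varepsilon$), and a class of languages $\mathcal C$ maps each alphabet $A$ to a set $\mathcal C(A)$ of languages over $A$. A word $w$ is viewed as a first-order structure whose domain is its set of positions $\{0,\dots,|w|-1\}$. The signature of $\mathrm{FO}(<)$ consists of a label predicate $a(x)$ for each $a\in A$ and the strict linear order $<$; the signature of $\mathrm{FO}(<,+1)$ has in addition the successor relation $x+1=y$, the unary predicates $\min(x)$ and $\max(x)$, which select the leftmost and the rightmost position, and a nullary predicate $\varepsilon$ that holds exactly in the empty word. A sentence is $\Sigma_n$ if pulling its quantifiers to the front yields (for some order of pulling them) a prefix with fewer than $n$ blocks of quantifiers, or with exactly $n$ blocks the first of which is existential (sentences themselves need not be prenex and are evaluated as they stand, also in the empty word; in particular disjunctions and conjunctions of $\Sigma_n$ sentences are $\Sigma_n$). A $\mathcal B\Sigma_n$ sentence is a Boolean combination of $\Sigma_n$ sentences. Write $\Sigma_n(<)$, $\mathcal B\Sigma_n(<)$, $\Sigma_n(<,+1)$, $\mathcal B\Sigma_n(<,+1)$ for the classes of languages defined by such sentences over the respective signature. Let $\mathrm{SU}(A)$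 be the set of finite Boolean combinations of languages $A^*w$ with $w\in A^*$. Given a finite partition $\mathbf P$ of $A^*$, write $[u]_{\mathbf P}$ for the block containing $u\in A^*$ and define $\tau_{\mathbf P}:A^*\to(\mathbf P\times A)^*$ by $$\tau_{\mathbf P}(a_1\cdots a_m)=([\varepsilon]_{\mathbf P},a_1)([a_1]_{\mathbf P},a_2)\cdots([a_1\cdots a_{m-1}]_{\mathbf P},a_m).$$ For classes $\mathcal C,\mathcal D$, the $\mathcal D$-enrichment $\mathcal C\circ\mathcal D$ of $\mathcal C$ is the class such that $L\in(\mathcal C\circ\mathcal D)(A)$ if and only if there are a finite partition $\mathbf P$ of $A^*$ into languages of $\mathcal D(A)$ and languages $L_P\in\mathcal C(\mathbf P\times A)$ for $P\in\mathbf P$ with $$L=\bigcup_{P\in\mathbf P}\bigl(P\cap\tau_{\mathbf P}^{-1}(L_P)\bigr).$$ **Proposition.** For every $n\ge 1$, $$\Sigma_n(<,+1)=\Sigma_n(<)\circ\mathrm{SU}\qquad\text{and}\qquad \mathcal B\Sigma_n(<,+1)=\mathcal B\Sigma_n(<)\circ\mathrm{SU}.$$ -/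

import Mathlib

open FirstOrder

universe u

namespace WordLogic

/-! ### Languages, classes of languages, suffix languages -/

/-- A class of languages maps every (finite) alphabet `A` to a set of languages over `A`,
a language over `A` being a subset of `A* = List A`. -/
def LangClass : Type (u + 1) := (A : Type u) → [Finite A] → Set (Set (List A))

/-- The suffix languages: `SU(A)` consists of the finite Boolean combinations of the languages
`A*w = {v | w is a suffix of v}`, for `w ∈ A*`. -/
def SU : LangClass.{u} := fun A _ =>
  {L | L ∈ BooleanSubalgebra.closure {K : Set (List A) | ∃ w : List A, K = {v | w <:+ v}}}

/-! ### Taggings and enrichment -/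

section Enrichment

variable {A : Type u} {P : Set (Set (List A))}

/-- The unique block of the partition `P` that contains the word `u`. -/
noncomputable def block (hP : Setoid.IsPartition P) (u : List A) : P :=
  ⟨(hP.2 u).choose, (hP.2 u).choose_spec.1.1⟩

/-- Check of the definition of `block`: it is the block containing the given word. -/
theorem mem_block (hP : Setoid.IsPartition P) (u : List A) : u ∈ (block hP u : Set (List A)) :=
  (hP.2 u).choose_spec.1.2

/-- The `P`-tagging `τ_P(w)` of `w = a₁ ⋯ aₘ`: its `i`-th letter is the pair formed by the block
containing the prefix `a₁ ⋯ aᵢ₋₁` and the letter `aᵢ`. -/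
noncomputable def tagging (hP : Setoid.IsPartition P) (w : List A) : List (P × A) :=
  List.ofFn fun i : Fin w.length => (block hP (w.take i), w.get i)

end Enrichment

/-- The `D`-enrichment `C ∘ D` of `C`: a language `L` over `A` belongs to it if and only if there
are a finite partition `P` of `A*` into languages of `D(A)` and languages `K Q ∈ C(P × A)`,
for `Q ∈ P`, such that `L` is the union over `Q ∈ P` of `Q ∩ τ_P⁻¹(K Q)`. -/
def enrichment (C D : LangClass.{u}) : LangClass.{u} := fun A _ =>
  {L | ∃ (P : Set (Set (List A))) (hP : Setoid.IsPartition P) (_ : Finite P),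
    (∀ Q ∈ P, Q ∈ D A) ∧
    ∃ K : P → Set (List (P × A)), (∀ Q, K Q ∈ C (P × A)) ∧
      L = ⋃ Q : P, ((Q : Set (List A)) ∩ tagging hP ⁻¹' K Q)}

/-! ### First-order logic over words -/

/-- The predicates of `FO(<)`: labels and the strict linear order. -/
inductive OrderRel (A : Type u) : ℕ → Type u
  | label (a : A) : OrderRel A 1
  | lt : OrderRel A 2

/-- The predicates of `FO(<,+1)`: those of `FO(<)`, together with the successor relation
`x + 1 = y`, the unary predicates `min` and `max`, and the `0`-ary predicate `ε`. -/
inductive SuccRel (A : Type u) : ℕ → Type u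
  | label (a : A) : SuccRel A 1
  | lt : SuccRel A 2
  | succ : SuccRel A 2
  | min : SuccRel A 1
  | max : SuccRel A 1
  | empty : SuccRel A 0

/-- The signature of `FO(<)` over the alphabet `A`. -/
def orderSig (A : Type u) : FirstOrder.Language.{0, u} := ⟨fun _ => Empty, OrderRel A⟩

/-- The signature of `FO(<,+1)` over the alphabet `A`. -/
def succSig (A : Type u) : FirstOrder.Language.{0, u} := ⟨fun _ => Empty, SuccRel A⟩

/-- A word `w` as a structure over the signature of `FO(<)`: its domain is the set of
positions `{0, …, |w| - 1}`, which is empty if `w` is. -/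
instance orderStructure {A : Type u} (w : List A) : (orderSig A).Structure (Fin w.length) where
  funMap := fun f => Empty.elim f
  RelMap := fun {_} r => match r with
    | .label a => fun x => w.get (x 0) = a
    | .lt => fun x => x 0 < x 1

/-- A word `w` as a structure over the signature of `FO(<,+1)`. -/
instance succStructure {A : Type u} (w : List A) : (succSig A).Structure (Fin w.length) where
  funMap := fun f => Empty.elim f
  RelMap := fun {_} r => match r with
    | .label a => fun x => w.get (x 0) = a
    | .lt => fun x => x 0 < x 1
    | .succ => fun x => (x 0 : ℕ) + 1 = x 1
    | .min => fun x => (x 0 : ℕ) = 0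
    | .max => fun x => (x 0 : ℕ) + 1 = w.length
    | .empty => fun _ => w = []

/-! ### Quantifier alternation -/

/-- The two sides of the quantifier alternation hierarchy. -/
inductive Side
  | sigma
  | pi

/-- The opposite side. -/
def Side.dual : Side → Side
  | .sigma => .pi
  | .pi => .sigma

/-- `IsLevel .sigma n φ` (resp. `IsLevel .pi n φ`) says that `φ` is a `Σₙ` (resp. `Πₙ`) formula:
pulling its quantifiers to the front yields, for some order of pulling them, a prefix with fewer
than `n` blocks of quantifiers, or with exactly `n` blocks the first of which is existential
(resp. universal). As `¬`, `∧`, `∨` and `∃` are abbreviations built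
from `⊥`, `→` and `∀`, the rules below imply that both levels are closed under `∧` and `∨`, that
negation exchanges them, and that, for `n ≥ 1`, `Σₙ` is closed under `∃` and `Πₙ` under `∀`.
No sentence is replaced by its prenex form, so that all sentences keep their meaning in the
empty word. -/
inductive IsLevel {L : FirstOrder.Language.{0, u}} {α : Type} :
    Side → ℕ → ∀ {k : ℕ}, L.BoundedFormula α k → Prop
  | falsum {s : Side} {n k : ℕ} :
      IsLevel s n (FirstOrder.Language.BoundedFormula.falsum : L.BoundedFormula α k)
  | equal {s : Side} {n k : ℕ} (t₁ t₂ : L.Term (α ⊕ Fin k)) :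
      IsLevel s n (FirstOrder.Language.BoundedFormula.equal t₁ t₂)
  | rel {s : Side} {n k l : ℕ} (R : L.Relations l) (ts : Fin l → L.Term (α ⊕ Fin k)) :
      IsLevel s n (FirstOrder.Language.BoundedFormula.rel R ts)
  | imp {s : Side} {n k : ℕ} {φ ψ : L.BoundedFormula α k} :
      IsLevel s.dual n φ → IsLevel s n ψ → IsLevel s n (φ.imp ψ)
  | all {n k : ℕ} {φ : L.BoundedFormula α (k + 1)} :
      IsLevel .pi (n + 1) φ → IsLevel .pi (n + 1) φ.all
  | lift {s : Side} {n k : ℕ} {φ : L.BoundedFormula α k} :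
      IsLevel s n φ → IsLevel s.dual (n + 1) φ

/-- The `Σₙ` sentences. -/
def IsSigma {L : FirstOrder.Language.{0, u}} (n : ℕ) (φ : L.Sentence) : Prop := IsLevel .sigma n φ

/-- The `BΣₙ` sentences: the Boolean combinations of `Σₙ` sentences. Since `⊥` is a `Σₙ` sentence,
closure under implication gives closure under all Boolean connectives. -/
inductive IsBSigma {L : FirstOrder.Language.{0, u}} (n : ℕ) : L.Sentence → Prop
  | of {φ : L.Sentence} : IsSigma n φ → IsBSigma n φ
  | imp {φ ψ : L.Sentence} : IsBSigma n φ → IsBSigma n ψ → IsBSigma n (φ.imp ψ)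

/-- The class `Σₙ(<)` of the languages defined by a `Σₙ` sentence of `FO(<)`. -/
def SigmaOrder (n : ℕ) : LangClass.{u} := fun A _ =>
  {L | ∃ φ : (orderSig A).Sentence, IsSigma n φ ∧ L = {w | Fin w.length ⊨ φ}}

/-- The class `BΣₙ(<)` of the languages defined by a `BΣₙ` sentence of `FO(<)`. -/
def BSigmaOrder (n : ℕ) : LangClass.{u} := fun A _ =>
  {L | ∃ φ : (orderSig A).Sentence, IsBSigma n φ ∧ L = {w | Fin w.length ⊨ φ}}

/-- The class `Σₙ(<,+1)` of the languages defined by a `Σₙ` sentence of `FO(<,+1)`. -/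
def SigmaSucc (n : ℕ) : LangClass.{u} := fun A _ =>
  {L | ∃ φ : (succSig A).Sentence, IsSigma n φ ∧ L = {w | Fin w.length ⊨ φ}}

/-- The class `BΣₙ(<,+1)` of the languages defined by a `BΣₙ` sentence of `FO(<,+1)`. -/
def BSigmaSucc (n : ℕ) : LangClass.{u} := fun A _ =>
  {L | ∃ φ : (succSig A).Sentence, IsBSigma n φ ∧ L = {w | Fin w.length ⊨ φ}}

end WordLogic

/-!
Both inclusions are proved formula by formula. A predicate on words with a tuple of positions is
treated as definable at a level of the hierarchy (`LevelDefinable`), and levels are closed under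
the connectives and under the quantifiers they allow.

*From the enrichment to the successor.* Whether a prefix `a₁ ⋯ aᵢ₋₁`, or the whole word, ends in a
fixed word `u` is decided by walking back along `u` with the successor relation. Predecessors are
unique, so the walk can be described with existential and also with universal
quantifiers, and membership in a suffix language is both `Σ₁` and `Π₁`
(`succSig_suffix_take`, `succSig_suffix`, `levelDefinable_of_mem_SU`). Substituting this for the
labels of the tagged word keeps the level, which is at least `1` (`levelDefinable_tagging`).

*From the successor to the enrichment.* Let `P` consist of the classes of words with the same last
`h` letters, for a large `h`. In the tagged word, the label of a position shows the
`h` letters before it, but `x + 1 = y` is not quantifier-free. So the positions of the given formula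
are not kept: each of them is represented by a base position, which is a variable of the new formula
or the end of the word, and a fixed offset to the left of it. Every base position has a
territory, an interval of offsets that contains those in use, and distinct territories are
more than `G` apart. A quantifier over a new position splits into finitely many cases in which the
position is within `G / 2` of a territory, and so gets a fixed offset from an old base
position, and the case in which it is far from all of them and gets a fresh base position at a
standard distance `H` to its right. That this base position is far from the others says that there
are enough positions in between, a `Σ₁` condition; it is a conjunct after an existential
and a premise after a universal quantifier, so the level does not change. The gap `G` is
halved at each quantifier. At the atoms, `<`, `+1` and `=` are decided by the offsets and by the
order of the base positions, while labels, `min` and the existence of the represented position are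
read off the tags (`exists_levelDefinable_base`). At the start the end of the word is the only base position;
its last letters are known from the block of the word, which is why the language `K Q`
may depend on the block `Q`. As every sufficiently large `G` works, the members of a Boolean
combination can share a partition (`exists_bSigma_order_sentence`).
-/

namespace WordLogic

/-! ### Predicates definable at a level of the alternation hierarchy -/

section Definability

open FirstOrder.Language

/-- A predicate `R w x` on words `w` over `A` with a `k`-tuple `x` of positions is definable at the
level `(s, n)` of the alternation hierarchy of `L` if a single formula of that level
defines it in all words. -/
def LevelDefinable {A : Type u} (L : FirstOrder.Language.{0, u})
    [∀ w : List A, L.Structure (Fin w.length)] (s : Side) (n k : ℕ)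
    (R : ∀ w : List A, (Fin k → Fin w.length) → Prop) : Prop :=
  ∃ φ : L.BoundedFormula Empty k, IsLevel s n φ ∧ ∀ w x, φ.Realize default x ↔ R w x

theorem Side.dual_dual (s : Side) : s.dual.dual = s := by cases s <;> rfl

namespace LevelDefinable

variable {A : Type u} {L : FirstOrder.Language.{0, u}} [∀ w : List A, L.Structure (Fin w.length)]
  {s : Side} {n k : ℕ} {R S : ∀ w : List A, (Fin k → Fin w.length) → Prop}

theorem congr (h : LevelDefinable L s n k R) (e : ∀ w x, R w x ↔ S w x) :
    LevelDefinable L s n k S := by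
  obtain ⟨φ, hφ, h⟩ := h
  exact ⟨φ, hφ, fun w x => (h w x).trans (e w x)⟩

theorem false : LevelDefinable (A := A) L s n k fun _ _ => False :=
  ⟨.falsum, .falsum, fun _ _ => Iff.rfl⟩

theorem imp (hR : LevelDefinable L s.dual n k R) (hS : LevelDefinable L s n k S) :
    LevelDefinable L s n k fun w x => R w x → S w x := by
  obtain ⟨φ, hφ, h⟩ := hR
  obtain ⟨ψ, hψ, h'⟩ := hS
  exact ⟨φ.imp ψ, .imp hφ hψ, fun w x => by rw [BoundedFormula.realize_imp, h, h']⟩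

theorem not (hR : LevelDefinable L s.dual n k R) :
    LevelDefinable L s n k fun w x => ¬ R w x :=
  imp hR false

theorem not_dual (hR : LevelDefinable L s n k R) :
    LevelDefinable L s.dual n k fun w x => ¬ R w x :=
  not (by rwa [Side.dual_dual])

theorem or (hR : LevelDefinable L s n k R) (hS : LevelDefinable L s n k S) :
    LevelDefinable L s n k fun w x => R w x ∨ S w x :=
  (imp hR.not_dual hS).congr fun _ _ => by tauto

theorem and (hR : LevelDefinable L s n k R) (hS : LevelDefinable L s n k S) :
    LevelDefinable L s n k fun w x => R w x ∧ S w x :=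
  (not (imp (s := s.dual) (R := R) (by rwa [Side.dual_dual]) hS.not_dual)).congr fun _ _ => by tauto

theorem const (p : Prop) : LevelDefinable (A := A) L s n k fun _ _ => p := by
  by_cases hp : p
  · exact (not false).congr fun _ _ => by simp [hp]
  · exact false.congr fun _ _ => by simp [hp]

theorem forall_finite {ι : Type*} [Finite ι]
    {R : ι → ∀ w : List A, (Fin k → Fin w.length) → Prop}
    (h : ∀ i, LevelDefinable L s n k (R i)) : LevelDefinable L s n k fun w x => ∀ i, R i w x := by
  classical
  have := Fintype.ofFinite ι
  suffices H : ∀ t : Finset ι, LevelDefinable L s n k fun w x => ∀ i ∈ t, R i w x from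
    (H Finset.univ).congr fun _ _ => by simp
  intro t
  induction t using Finset.induction_on with
  | empty => exact (const True).congr fun _ _ => by simp
  | insert i t _ ih => exact ((h i).and ih).congr fun _ _ => by simp

theorem exists_finite {ι : Type*} [Finite ι]
    {R : ι → ∀ w : List A, (Fin k → Fin w.length) → Prop}
    (h : ∀ i, LevelDefinable L s n k (R i)) : LevelDefinable L s n k fun w x => ∃ i, R i w x :=
  (not (forall_finite fun i => (h i).not_dual)).congr fun _ _ => by simp

theorem all {R : ∀ w : List A, (Fin (k + 1) → Fin w.length) → Prop}
    (h : LevelDefinable L .pi (n + 1) (k + 1) R) :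
    LevelDefinable L .pi (n + 1) k fun w x => ∀ y, R w (Fin.snoc x y) := by
  obtain ⟨φ, hφ, h⟩ := h
  exact ⟨φ.all, .all hφ, fun w x => by simp only [BoundedFormula.realize_all, h]⟩

theorem ex {R : ∀ w : List A, (Fin (k + 1) → Fin w.length) → Prop}
    (h : LevelDefinable L .sigma (n + 1) (k + 1) R) :
    LevelDefinable L .sigma (n + 1) k fun w x => ∃ y, R w (Fin.snoc x y) :=
  (not (s := .sigma) (all h.not_dual)).congr fun _ _ => by simp

theorem lift (h : LevelDefinable L s n k R) : LevelDefinable L s.dual (n + 1) k R := by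
  obtain ⟨φ, hφ, h⟩ := h
  exact ⟨φ, .lift hφ, h⟩

end LevelDefinable

end Definability

/-- Over a signature without function symbols, terms are variables; here without free variables
outside the bounded ones. -/
theorem exists_eq_var {L : FirstOrder.Language.{0, u}} [hL : ∀ n, IsEmpty (L.Functions n)] {k : ℕ}
    (t : L.Term (Empty ⊕ Fin k)) : ∃ i, t = .var (.inr i) := by
  cases t with
  | var i =>
    rcases i with i | i
    · exact i.elim
    · exact ⟨i, rfl⟩
  | func f => exact (hL _).elim f

instance (A : Type u) (n : ℕ) : IsEmpty ((orderSig A).Functions n) :=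
  inferInstanceAs (IsEmpty Empty)

instance (A : Type u) (n : ℕ) : IsEmpty ((succSig A).Functions n) :=
  inferInstanceAs (IsEmpty Empty)

/-! ### Atomic predicates -/

section Atoms

variable {A : Type u} {s : Side} {n k : ℕ}

theorem orderSig_label (a : A) (i : Fin k) :
    LevelDefinable (orderSig A) s n k fun (w : List A) x => w.get (x i) = a :=
  ⟨.rel (OrderRel.label a : (orderSig A).Relations 1) ![.var (.inr i)], .rel _ _,
    fun _ _ => Iff.rfl⟩

theorem orderSig_lt (i j : Fin k) :
    LevelDefinable (orderSig A) s n k fun (_ : List A) x => x i < x j :=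
  ⟨.rel (OrderRel.lt : (orderSig A).Relations 2) ![.var (.inr i), .var (.inr j)], .rel _ _,
    fun _ _ => Iff.rfl⟩

theorem orderSig_letter [Finite A] (p : A → Prop) (i : Fin k) :
    LevelDefinable (orderSig A) s n k fun (w : List A) x => p (w.get (x i)) :=
  (LevelDefinable.exists_finite fun a => (LevelDefinable.const (p a)).and
    (orderSig_label a i)).congr fun _ _ => by simp

theorem succSig_label (a : A) (i : Fin k) :
    LevelDefinable (succSig A) s n k fun (w : List A) x => w.get (x i) = a :=
  ⟨.rel (SuccRel.label a : (succSig A).Relations 1) ![.var (.inr i)], .rel _ _,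
    fun _ _ => Iff.rfl⟩

theorem succSig_lt (i j : Fin k) :
    LevelDefinable (succSig A) s n k fun (_ : List A) x => x i < x j :=
  ⟨.rel (SuccRel.lt : (succSig A).Relations 2) ![.var (.inr i), .var (.inr j)], .rel _ _,
    fun _ _ => Iff.rfl⟩

theorem succSig_eq (i j : Fin k) :
    LevelDefinable (succSig A) s n k fun (_ : List A) x => x i = x j :=
  ⟨.equal (.var (.inr i)) (.var (.inr j)), .equal _ _, fun _ _ => Iff.rfl⟩

theorem succSig_succ (i j : Fin k) :
    LevelDefinable (succSig A) s n k fun (_ : List A) x => (x i : ℕ) + 1 = x j :=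
  ⟨.rel (SuccRel.succ : (succSig A).Relations 2) ![.var (.inr i), .var (.inr j)], .rel _ _,
    fun _ _ => Iff.rfl⟩

theorem succSig_min (i : Fin k) :
    LevelDefinable (succSig A) s n k fun (_ : List A) x => (x i : ℕ) = 0 :=
  ⟨.rel (SuccRel.min : (succSig A).Relations 1) ![.var (.inr i)], .rel _ _, fun _ _ => Iff.rfl⟩

theorem succSig_max (i : Fin k) :
    LevelDefinable (succSig A) s n k fun (w : List A) x => (x i : ℕ) + 1 = w.length :=
  ⟨.rel (SuccRel.max : (succSig A).Relations 1) ![.var (.inr i)], .rel _ _, fun _ _ => Iff.rfl⟩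

theorem succSig_empty : LevelDefinable (succSig A) s n k fun (w : List A) _ => w = [] :=
  ⟨.rel (SuccRel.empty : (succSig A).Relations 0) ![], .rel _ _, fun _ _ => Iff.rfl⟩

end Atoms

/-! ### Suffix languages in the signature with successor -/

section Suffix

variable {A : Type u} {s : Side} {n k : ℕ}

theorem append_singleton_suffix_take_iff (u w : List A) (a : A) (p : ℕ) (hp : p ≤ w.length) :
    u ++ [a] <:+ w.take p ↔
      ∃ y : Fin w.length, (y : ℕ) + 1 = p ∧ w.get y = a ∧ u <:+ w.take y := by
  rcases p with _ | p
  · simp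
  · have hp' : p < w.length := hp
    rw [List.take_succ_eq_append_getElem hp', List.suffix_concat_iff]
    constructor
    · rintro (h | ⟨t, h, ht⟩)
      · simp at h
      · obtain ⟨rfl, h⟩ := List.append_inj' h rfl
        exact ⟨⟨p, hp'⟩, rfl, by simpa using h.symm, ht⟩
    · rintro ⟨y, hy, rfl, ht⟩
      obtain rfl : (y : ℕ) = p := by omega
      exact Or.inr ⟨u, rfl, ht⟩

/-- A prefix ending in a given word `u` is recognized by walking back along `u` with the
successor relation. As predecessors are unique, they may be quantified existentially or
universally. -/
theorem succSig_suffix_take (u : List A) (s : Side) (n : ℕ) {k : ℕ} (i : Fin k) :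
    LevelDefinable (succSig A) s (n + 1) k fun (w : List A) x => u <:+ w.take (x i) := by
  induction u using List.reverseRecOn generalizing k with
  | nil => exact (LevelDefinable.const True).congr fun _ _ => by simp
  | append_singleton u a ih =>
    have H := fun (w : List A) (x : Fin k → Fin w.length) =>
      append_singleton_suffix_take_iff u w a (x i) (x i).2.le
    cases s with
    | sigma =>
      refine LevelDefinable.congr (((succSig_succ (Fin.last k) i.castSucc).and
        ((succSig_label a (Fin.last k)).and (ih (Fin.last k)))).ex) fun w x => ?_
      simp only [Fin.snoc_last, Fin.snoc_castSucc, H]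
    | pi =>
      refine LevelDefinable.congr ((LevelDefinable.not (s := .pi) (succSig_min i)).and
        ((LevelDefinable.imp (s := .pi) (succSig_succ (Fin.last k) i.castSucc)
        ((succSig_label a (Fin.last k)).and (ih (Fin.last k)))).all)) fun w x => ?_
      simp only [Fin.snoc_last, Fin.snoc_castSucc, H]
      constructor
      · rintro ⟨h0, h⟩
        have := (x i).2
        exact ⟨⟨x i - 1, by omega⟩, by simp; omega, h _ (by simp; omega)⟩
      · rintro ⟨y, hy, h⟩
        refine ⟨by omega, fun z hz => ?_⟩
        obtain rfl : z = y := by ext; omega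
        exact h

theorem succSig_suffix (u : List A) (s : Side) (n k : ℕ) :
    LevelDefinable (succSig A) s (n + 1) k fun (w : List A) _ => u <:+ w := by
  induction u using List.reverseRecOn with
  | nil => exact (LevelDefinable.const True).congr fun _ _ => by simp
  | append_singleton u a _ =>
    have H := fun (w : List A) =>
      append_singleton_suffix_take_iff u w a w.length le_rfl
    simp only [List.take_length] at H
    have ih := fun s => succSig_suffix_take u s n (Fin.last k)
    cases s with
    | sigma =>
      refine LevelDefinable.congr (((succSig_max (Fin.last k)).and
        ((succSig_label a (Fin.last k)).and (ih _))).ex) fun w x => ?_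
      simp only [Fin.snoc_last, H]
    | pi =>
      refine LevelDefinable.congr ((LevelDefinable.not (s := .pi) succSig_empty).and
        ((LevelDefinable.imp (s := .pi) (succSig_max (Fin.last k))
        ((succSig_label a (Fin.last k)).and (ih _))).all)) fun w x => ?_
      simp only [Fin.snoc_last, H]
      constructor
      · rintro ⟨h0, h⟩
        have := List.length_pos_iff.2 h0
        exact ⟨⟨w.length - 1, by omega⟩, by simp; omega, h _ (by simp; omega)⟩
      · rintro ⟨y, hy, h⟩
        refine ⟨fun h0 => by simp [h0] at hy, fun z hz => ?_⟩
        obtain rfl : z = y := by ext; omega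
        exact h

/-- Boolean combinations stay definable because both sides of the level are available. -/
theorem levelDefinable_of_mem_SU [Finite A] {K : Set (List A)} (hK : K ∈ SU A)
    (f : ∀ w : List A, (Fin k → Fin w.length) → List A)
    (hf : ∀ (u : List A) (s : Side),
      LevelDefinable (succSig A) s n k fun (w : List A) x => u <:+ f w x)
    (s : Side) : LevelDefinable (succSig A) s n k fun (w : List A) x => f w x ∈ K := by
  induction hK using BooleanSubalgebra.closure_bot_sup_induction generalizing s with
  | mem K hK =>
    obtain ⟨u, rfl⟩ := hK
    exact hf u s
  | bot => exact LevelDefinable.false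
  | sup K _ K' _ h h' => exact (h s).or (h' s)
  | compl K _ h => exact LevelDefinable.not (h _)

end Suffix

/-! ### From an enrichment to the signature with successor -/

section OfEnrichment

variable {A : Type u} {P : Set (Set (List A))}

theorem length_tagging (hP : Setoid.IsPartition P) (w : List A) :
    (tagging hP w).length = w.length := by
  simp [tagging]

theorem get_tagging (hP : Setoid.IsPartition P) (w : List A) (x : Fin w.length)
    (y : Fin (tagging hP w).length) (h : (x : ℕ) = y) :
    (tagging hP w).get y = (block hP (w.take x), w.get x) := by
  obtain ⟨y, hy⟩ := y
  obtain ⟨x, hx⟩ := x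
  obtain rfl : x = y := h
  simp [tagging]

theorem block_eq_iff (hP : Setoid.IsPartition P) (u : List A) (Q : P) :
    block hP u = Q ↔ u ∈ (Q : Set (List A)) := by
  constructor
  · rintro rfl
    exact mem_block hP u
  · intro h
    exact Subtype.ext ((hP.2 u).unique ⟨(block hP u).2, mem_block hP u⟩ ⟨Q.2, h⟩)

/-- A formula about the tagged word is turned into one about the word itself by replacing the
labels. At level `0` this creates quantifiers, but the result is on both sides of level `1`. -/
theorem levelDefinable_tagging [Finite A] (hP : Setoid.IsPartition P) (hSU : ∀ Q ∈ P, Q ∈ SU A)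
    {s : Side} {n k : ℕ} {φ : (orderSig (P × A)).BoundedFormula Empty k} (hφ : IsLevel s n φ)
    (s' : Side) (n' : ℕ) (hn : n < n' + 1 ∨ s = s' ∧ n = n' + 1) :
    ∃ R, LevelDefinable (succSig A) s' (n' + 1) k R ∧
      ∀ (w : List A) (x : Fin k → Fin w.length) (y : Fin k → Fin (tagging hP w).length),
        (∀ i, (x i : ℕ) = y i) → (φ.Realize default y ↔ R w x) := by
  induction hφ generalizing s' n' with
  | falsum => exact ⟨_, .false, fun _ _ _ _ => Iff.rfl⟩
  | equal t₁ t₂ =>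
    obtain ⟨i, rfl⟩ := exists_eq_var t₁
    obtain ⟨j, rfl⟩ := exists_eq_var t₂
    refine ⟨_, succSig_eq i j, fun w x y h => ?_⟩
    change y i = y j ↔ _
    rw [Fin.ext_iff, Fin.ext_iff, h, h]
  | rel r ts =>
    choose i hi using fun j => exists_eq_var (ts j)
    obtain rfl : ts = fun j => .var (.inr (i j)) := funext hi
    cases r with
    | label b =>
      refine ⟨_, (levelDefinable_of_mem_SU (hSU _ b.1.2) _
        (fun u s => succSig_suffix_take u s n' (i 0)) s').and (succSig_label b.2 (i 0)),
        fun w x y h => ?_⟩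
      change (tagging hP w).get (y (i 0)) = b ↔ _
      rw [get_tagging hP w _ _ (h _), ← block_eq_iff hP, Prod.ext_iff]
    | lt =>
      refine ⟨_, succSig_lt (i 0) (i 1), fun w x y h => ?_⟩
      change y (i 0) < y (i 1) ↔ _
      rw [Fin.lt_def, Fin.lt_def, h, h]
  | @imp s n k φ ψ _ _ ih₁ ih₂ =>
    obtain ⟨R, hR, h₁⟩ := ih₁ s'.dual n' (hn.imp_right fun h => ⟨by rw [h.1], h.2⟩)
    obtain ⟨S, hS, h₂⟩ := ih₂ s' n' hn
    exact ⟨_, hR.imp hS, fun w x y h => by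
      rw [Language.BoundedFormula.realize_imp, h₁ w x y h, h₂ w x y h]⟩
  | @all n k φ _ ih =>
    have key : ∀ m, n ≤ m → ∃ R, LevelDefinable (succSig A) .pi (m + 1) k R ∧
        ∀ (w : List A) (x : Fin k → Fin w.length) (y : Fin k → Fin (tagging hP w).length),
        (∀ i, (x i : ℕ) = y i) → (φ.all.Realize default y ↔ R w x) := by
      intro m hm
      obtain ⟨R, hR, h⟩ := ih .pi m (by simp; omega)
      refine ⟨_, hR.all, fun w x y hxy => ?_⟩
      rw [Language.BoundedFormula.realize_all]
      refine (finCongr (length_tagging hP w)).forall_congr fun a => h w _ _ fun i => ?_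
      refine Fin.lastCases ?_ (fun i => ?_) i
      · simp
      · simp [hxy]
    rcases hn with hn | ⟨rfl, hn⟩
    · cases s' with
      | pi => exact key n' (by omega)
      | sigma =>
        obtain ⟨m, rfl⟩ : ∃ m, n' = m + 1 := ⟨n' - 1, by omega⟩
        obtain ⟨R, hR, h⟩ := key m (by omega)
        exact ⟨R, hR.lift, h⟩
    · exact key n' (by omega)
  | lift _ ih => exact ih s' n' (Or.inl (by omega))

end OfEnrichment

/-! ### Tagging by the last letters of prefixes -/

section LastLetters

variable {A B : Type u}

/-- The last `h` letters of `u`, or all of them if there are fewer, the last one first. -/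
def lastLetters (h : ℕ) (u : List A) : List A := u.reverse.take h

theorem le_length_lastLetters_take {h d p : ℕ} {w : List A} (hd : d ≤ h) (hp : p ≤ w.length) :
    d ≤ (lastLetters h (w.take p)).length ↔ d ≤ p := by
  simp [lastLetters]
  omega

theorem lastLetters_take_getElem? {h d p x : ℕ} {w : List A} (hd : d < h) (hp : p ≤ w.length)
    (hx : x + (d + 1) = p) : (lastLetters h (w.take p))[d]? = w[x]? := by
  have h1 : d < (w.take p).length := by simp; omega
  rw [lastLetters, List.getElem?_take_of_lt hd, List.getElem?_reverse h1,
    List.getElem?_take_of_lt (by simp; omega)]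
  congr 1
  simp
  omega

/-- The word `t` tags `w` with the last `h` letters before each position, as read by `f`. -/
def IsLastTagging (h : ℕ) (f : B → List A) (w : List A) (t : List B) : Prop :=
  t.length = w.length ∧ ∀ p : Fin t.length, f (t.get p) = lastLetters h (w.take p)

end LastLetters

/-! ### Positions given relative to base positions -/

section Base

variable {m N M : ℕ}

/-- The base positions: those assigned to the `m` variables, and the end `N` of the word,
which is `none`. -/
def base (N : ℕ) (b : Fin m → Fin M) (i : Option (Fin m)) : ℕ := i.elim N fun j => b j

/-- The territories of the base positions, that is, the intervals that reach from
`hi i` to `lo i` positions to the left of the base position `i`, are more than `G` apart. -/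
def Separated (G : ℕ) (lo hi : Option (Fin m) → ℕ) (N : ℕ) (b : Fin m → Fin M) : Prop :=
  ∀ i j, i ≠ j → base N b i + hi j + G < base N b j + lo i ∨
    base N b j + hi i + G < base N b i + lo j

/-- The side conditions on territories that do not depend on the word: each of them contains the
offset `H` at which a new base position is put, that of the end of the word reaches up to the
last position, and all of them can grow by `G` without reaching their base position or
leaving the range of `h` letters. -/
structure Admissible (G H h : ℕ) (lo hi : Option (Fin m) → ℕ) : Prop where
  one_le : ∀ i, 1 ≤ lo i
  lo_le : ∀ i, lo i ≤ H
  le_hi : ∀ i, H ≤ hi i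
  hi_lt : ∀ i, hi i + G < h
  lo_none : lo none = 1
  lt_lo : ∀ j, G < lo (some j)
  lt_H : G < H

/-- The offset `d` is at most `r` away from the territory of `i`. It has to be positive, as the tag
of a base position shows only the letters strictly to its left. -/
def Near (r : ℕ) (lo hi : Option (Fin m) → ℕ) (i : Option (Fin m)) (d : ℕ) : Prop :=
  1 ≤ d ∧ lo i ≤ d + r ∧ d ≤ hi i + r

theorem Admissible.update {G H h : ℕ} {lo hi : Option (Fin m) → ℕ} (a : Admissible G H h lo hi)
    {i : Option (Fin m)} {d : ℕ} (hd : Near (G / 2) lo hi i d) :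
    Admissible (G / 2) H h (Function.update lo i (min (lo i) d))
      (Function.update hi i (max (hi i) d)) := by
  obtain ⟨h1, h2, h3⟩ := hd
  obtain ⟨a1, a2, a3, a4, a5, a6, a7⟩ := a
  refine ⟨fun j => ?_, fun j => ?_, fun j => ?_, fun j => ?_, ?_, fun j => ?_, by omega⟩
  · have := a1 j
    by_cases e : j = i
    · subst e; simp; omega
    · simpa [e]
  · have := a2 j
    by_cases e : j = i
    · subst e; simp; omega
    · simpa [e]
  · have := a3 j
    by_cases e : j = i
    · subst e; simp; omega
    · simpa [e]
  · have := a4 j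
    by_cases e : j = i
    · subst e; simp; omega
    · simp [e]; omega
  · by_cases e : none = i
    · subst e; simp; omega
    · simpa [e]
  · have := a6 j
    by_cases e : some j = i
    · subst e; simp; omega
    · simp [e]; omega

theorem Separated.update {G : ℕ} {lo hi : Option (Fin m) → ℕ} {b : Fin m → Fin M}
    (s : Separated G lo hi N b) {i : Option (Fin m)} {d : ℕ} (hd : Near (G / 2) lo hi i d) :
    Separated (G / 2) (Function.update lo i (min (lo i) d))
      (Function.update hi i (max (hi i) d)) N b := by
  obtain ⟨h1, h2, h3⟩ := hd
  intro j l hjl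
  have := s j l hjl
  by_cases e : j = i
  · subst e
    simp [hjl.symm]
    omega
  · by_cases e' : l = i
    · subst e'
      simp [e]
      omega
    · simp [e, e']
      omega

/-- The values `g` on the old base positions, together with `H` for a new one. -/
def extend (g : Option (Fin m) → ℕ) (H : ℕ) : Option (Fin (m + 1)) → ℕ
  | none => g none
  | some j => Fin.lastCases (motive := fun _ => ℕ) H (fun j => g (some j)) j

@[simp]
theorem extend_last (g : Option (Fin m) → ℕ) (H : ℕ) : extend g H (some (Fin.last m)) = H := by
  simp [extend]

@[simp]
theorem extend_map (g : Option (Fin m) → ℕ) (H : ℕ) (i : Option (Fin m)) :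
    extend g H (i.map Fin.castSucc) = g i := by
  cases i <;> simp [extend]

theorem base_snoc_last (N : ℕ) (b : Fin m → Fin M) (z : Fin M) :
    base N (Fin.snoc b z : Fin (m + 1) → Fin M) (some (Fin.last m)) = z := by
  simp [base]

theorem base_snoc_map (N : ℕ) (b : Fin m → Fin M) (z : Fin M) (i : Option (Fin m)) :
    base N (Fin.snoc b z : Fin (m + 1) → Fin M) (i.map Fin.castSucc) = base N b i := by
  cases i <;> simp [base]

theorem eq_last_or_map (i : Option (Fin (m + 1))) :
    i = some (Fin.last m) ∨ ∃ j : Option (Fin m), i = j.map Fin.castSucc := by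
  rcases i with _ | i
  · exact Or.inr ⟨none, rfl⟩
  · refine Fin.lastCases (Or.inl rfl) (fun j => Or.inr ⟨some j, rfl⟩) i

theorem Admissible.extend {G H h : ℕ} {lo hi : Option (Fin m) → ℕ} (a : Admissible G H h lo hi) :
    Admissible (G / 2) H h (extend lo H) (extend hi H) := by
  have a3 := a.le_hi none
  have a4 := a.hi_lt none
  have a7 := a.lt_H
  refine ⟨fun i => ?_, fun i => ?_, fun i => ?_, fun i => ?_, a.lo_none, fun i => ?_, by omega⟩
  · obtain rfl | ⟨j, rfl⟩ := eq_last_or_map i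
    · simp; omega
    · simpa using a.one_le j
  · obtain rfl | ⟨j, rfl⟩ := eq_last_or_map i
    · simp
    · simpa using a.lo_le j
  · obtain rfl | ⟨j, rfl⟩ := eq_last_or_map i
    · simp
    · simpa using a.le_hi j
  · obtain rfl | ⟨j, rfl⟩ := eq_last_or_map i
    · simp; omega
    · have := a.hi_lt j
      simp; omega
  · refine Fin.lastCases ?_ (fun j => ?_) i
    · simp; omega
    · have := a.lt_lo j
      rw [show some j.castSucc = (some j).map Fin.castSucc from rfl, extend_map]
      omega

/-- The position `H` to the left of `z` is more than `r` away from the territory of `i`. -/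
def Far (r H : ℕ) (lo hi : Option (Fin m) → ℕ) (N : ℕ) (b : Fin m → Fin M) (z : ℕ)
    (i : Option (Fin m)) : Prop :=
  z + (hi i + r - H) < base N b i ∨ i ≠ none ∧ base N b i + (H + r - lo i) < z

theorem Separated.extend {G H h : ℕ} {lo hi : Option (Fin m) → ℕ} {b : Fin m → Fin M}
    (a : Admissible G H h lo hi) (s : Separated G lo hi N b) {z : Fin M}
    (hz : ∀ i, Far (G / 2) H lo hi N b z i) :
    Separated (G / 2) (extend lo H) (extend hi H) N (Fin.snoc b z : Fin (m + 1) → Fin M) := by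
  have key : ∀ i, (z : ℕ) + hi i + G / 2 < base N b i + H ∨
      base N b i + H + G / 2 < z + lo i := by
    intro i
    have := a.lo_le i
    have := a.le_hi i
    rcases hz i with h | ⟨-, h⟩ <;> omega
  intro i j hij
  obtain rfl | ⟨i, rfl⟩ := eq_last_or_map i <;> obtain rfl | ⟨j, rfl⟩ := eq_last_or_map j
  · exact absurd rfl hij
  · simp only [extend_last, extend_map, base_snoc_last, base_snoc_map]
    exact key j
  · simp only [extend_last, extend_map, base_snoc_last, base_snoc_map]
    exact (key i).symm
  · simp only [extend_map, base_snoc_map]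
    have := s i j fun e => hij (by rw [e])
    omega

/-- A position that is not near any territory is far from all of them, so that a new
base position fits in to the right of it. -/
theorem far_of_not_near {G H h : ℕ} {lo hi : Option (Fin m) → ℕ} {b : Fin m → Fin M}
    (a : Admissible G H h lo hi) {x : ℕ} (hx : x < N)
    (hfar : ∀ i d, x + d = base N b i → ¬ Near (G / 2) lo hi i d) :
    x + H < N ∧ ∀ i, Far (G / 2) H lo hi N b (x + H) i := by
  have a5 := a.lo_none
  have a3 := a.le_hi none
  have h0 := hfar none (N - x) (by simp [base]; omega)
  unfold Near at h0
  refine ⟨by omega, fun i => ?_⟩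
  cases i with
  | none => left; simp [base]; omega
  | some j =>
    have := a.lo_le (some j)
    have := a.le_hi (some j)
    have := a.lt_lo j
    have := hfar (some j) (base N b (some j) - x)
    unfold Near at this
    unfold Far
    simp only [ne_eq, reduceCtorEq, not_false_eq_true, true_and]
    omega

end Base

/-! ### Eliminating the successor -/

section Elimination

variable {A B : Type u} {s : Side} {n m : ℕ}

theorem base_le (N : ℕ) (b : Fin m → Fin N) (i : Option (Fin m)) : base N b i ≤ N := by
  cases i with
  | none => exact le_rfl
  | some j => exact (b j).2.le

theorem orderSig_base_lt (i j : Option (Fin m)) :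
    LevelDefinable (orderSig B) s n m fun (t : List B) b =>
      base t.length b i < base t.length b j := by
  cases i with
  | none =>
    exact LevelDefinable.false.congr fun t b => by simpa [base] using base_le _ b j
  | some i =>
    cases j with
    | none => exact (LevelDefinable.const True).congr fun t b => by simp [base]
    | some j => exact (orderSig_lt i j).congr fun t b => by simp [base]

/-- Distances between base positions are bounded from below by guessing positions in between. -/
theorem orderSig_base_add_lt (c : ℕ) (i j : Option (Fin m)) :
    LevelDefinable (orderSig B) .sigma (n + 1) m fun (t : List B) b =>
      base t.length b i + c < base t.length b j := by
  induction c generalizing m with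
  | zero => exact orderSig_base_lt i j
  | succ c ih =>
    cases i with
    | none =>
      refine LevelDefinable.false.congr fun t b => ?_
      have := base_le _ b j
      simp [base] at this ⊢
      omega
    | some i =>
      refine (((orderSig_lt i.castSucc (Fin.last m)).and
        (ih (some (Fin.last m)) (j.map Fin.castSucc))).ex).congr fun t b => ?_
      simp only [Fin.snoc_last, Fin.snoc_castSucc, base_snoc_last, base_snoc_map, Fin.lt_def]
      have := base_le _ b j
      constructor
      · rintro ⟨z, h, h'⟩
        simp only [base, Option.elim] at h' ⊢
        omega
      · intro h
        simp only [base, Option.elim] at h this ⊢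
        exact ⟨⟨b i + 1, by omega⟩, by simp, by simp only; omega⟩

theorem orderSig_far (r H : ℕ) (lo hi : Option (Fin m) → ℕ) (i : Option (Fin m)) :
    LevelDefinable (orderSig B) .sigma (n + 1) (m + 1) fun (t : List B) b =>
      Far r H lo hi t.length (fun j => b j.castSucc) (b (Fin.last m)) i := by
  refine ((orderSig_base_add_lt (hi i + r - H) (some (Fin.last m)) (i.map Fin.castSucc)).or
    ((LevelDefinable.const (i ≠ none)).and (orderSig_base_add_lt (H + r - lo i)
      (i.map Fin.castSucc) (some (Fin.last m))))).congr fun t b => ?_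
  cases i <;> rfl

/-- The last letters before a base position, if `v` are those of the whole word. -/
def baseLetters (v : List A) (f : B → List A) (t : List B) (b : Fin m → Fin t.length)
    (i : Option (Fin m)) : List A :=
  i.elim v fun j => f (t.get (b j))

theorem orderSig_baseLetters [Finite B] (p : List A → Prop) (v : List A) (f : B → List A)
    (i : Option (Fin m)) :
    LevelDefinable (orderSig B) s n m fun (t : List B) b => p (baseLetters v f t b i) := by
  cases i with
  | none => exact LevelDefinable.const (p v)
  | some j => exact orderSig_letter (fun a => p (f a)) j

theorem IsLastTagging.baseLetters_eq {h : ℕ} {f : B → List A} {w : List A} {t : List B}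
    (ht : IsLastTagging h f w t) {v : List A} (hv : lastLetters h w = v)
    (b : Fin m → Fin t.length) (i : Option (Fin m)) :
    baseLetters v f t b i = lastLetters h (w.take (base t.length b i)) := by
  cases i with
  | none => simp [baseLetters, base, ht.1, hv]
  | some j => exact ht.2 _

/-- A formula with successor about positions that are given by offsets from base positions is
expressed by an order formula of the same level about the base positions, in words tagged with
sufficiently many last letters. The gap `G` between territories has to be large in terms of
the quantifier depth, and is halved at each quantifier: the new position is either near a
territory, where there are finitely many choices, or `H` to the left of a new base position. -/
theorem exists_levelDefinable_base {k : ℕ}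
    {φ : (succSig A).BoundedFormula Empty k} (hφ : IsLevel s n φ) :
    ∃ g, ∀ G, g ≤ G → ∀ (B : Type u) [Finite B] (f : B → List A) (h H : ℕ) (v : List A) (m : ℕ)
      (c : Fin k → Option (Fin m)) (d : Fin k → ℕ) (lo hi : Option (Fin m) → ℕ),
      Admissible G H h lo hi →
      (∀ i, lo (c i) ≤ d i ∧ d i ≤ hi (c i)) →
      ∃ R, LevelDefinable (orderSig B) s n m R ∧
        ∀ (w : List A) (t : List B), IsLastTagging h f w t → lastLetters h w = v →
        ∀ (b : Fin m → Fin t.length) (x : Fin k → Fin w.length),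
        (∀ i, x i + d i = base t.length b (c i)) → Separated G lo hi t.length b →
        (φ.Realize default x ↔ R t b) := by
  induction hφ with
  | falsum =>
    exact ⟨0, fun _ _ _ _ _ _ _ _ _ _ _ _ _ _ _ => ⟨_, .false, fun _ _ _ _ _ _ _ _ => Iff.rfl⟩⟩
  | equal t₁ t₂ =>
    obtain ⟨i, rfl⟩ := exists_eq_var t₁
    obtain ⟨j, rfl⟩ := exists_eq_var t₂
    refine ⟨1, fun G hG B _ f h H v m c d lo hi a hd =>
      ⟨_, .const (c i = c j ∧ d i = d j), fun w t ht hv b x hx sep => ?_⟩⟩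
    change x i = x j ↔ _
    have hi' := hx i
    have hj' := hx j
    rw [Fin.ext_iff]
    by_cases e : c i = c j
    · simp only [e, true_and]
      rw [e] at hi'
      omega
    · simp only [e, false_and, iff_false]
      have := sep _ _ e
      have := hd i
      have := hd j
      omega
  | rel r ts =>
    choose p hp using fun j => exists_eq_var (ts j)
    obtain rfl : ts = fun j => .var (.inr (p j)) := funext hp
    cases r with
    | label l =>
      refine ⟨0, fun G hG B _ f h H v m c d lo hi a hd => ⟨_, orderSig_baseLetters
        (fun u => u[d (p 0) - 1]? = some l) v f (c (p 0)), fun w t ht hv b x hx sep => ?_⟩⟩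
      change w.get (x (p 0)) = l ↔ _
      have h1 := hd (p 0)
      have h2 := a.one_le (c (p 0))
      have h3 := a.hi_lt (c (p 0))
      have h4 := base_le _ b (c (p 0))
      rw [ht.baseLetters_eq hv, lastLetters_take_getElem? (x := x (p 0)) (by omega)
        (h4.trans ht.1.le) (by have := hx (p 0); omega)]
      simp
    | lt =>
      refine ⟨1, fun G hG B _ f h H v m c d lo hi a hd =>
        ⟨_, ((LevelDefinable.const (c (p 0) = c (p 1) ∧ d (p 1) < d (p 0))).or
          (orderSig_base_lt (c (p 0)) (c (p 1)))), fun w t ht hv b x hx sep => ?_⟩⟩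
      change x (p 0) < x (p 1) ↔ _
      have hi' := hx (p 0)
      have hj' := hx (p 1)
      rw [Fin.lt_def]
      by_cases e : c (p 0) = c (p 1)
      · simp only [e, true_and, lt_irrefl, or_false]
        rw [e] at hi'
        omega
      · simp only [e, false_and, false_or]
        have := sep _ _ e
        have := hd (p 0)
        have := hd (p 1)
        have := a.lo_le (c (p 0))
        have := a.lo_le (c (p 1))
        have := a.le_hi (c (p 0))
        have := a.le_hi (c (p 1))
        omega
    | succ =>
      refine ⟨1, fun G hG B _ f h H v m c d lo hi a hd =>
        ⟨_, .const (c (p 0) = c (p 1) ∧ d (p 0) = d (p 1) + 1), fun w t ht hv b x hx sep => ?_⟩⟩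
      change (x (p 0) : ℕ) + 1 = x (p 1) ↔ _
      have hi' := hx (p 0)
      have hj' := hx (p 1)
      by_cases e : c (p 0) = c (p 1)
      · simp only [e, true_and]
        rw [e] at hi'
        omega
      · simp only [e, false_and, iff_false]
        have := sep _ _ e
        have := hd (p 0)
        have := hd (p 1)
        omega
    | min =>
      refine ⟨0, fun G hG B _ f h H v m c d lo hi a hd => ⟨_, orderSig_baseLetters
        (fun u => ¬ d (p 0) + 1 ≤ u.length) v f (c (p 0)), fun w t ht hv b x hx sep => ?_⟩⟩
      change (x (p 0) : ℕ) = 0 ↔ _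
      have h1 := hd (p 0)
      have h2 := hx (p 0)
      have h3 := a.hi_lt (c (p 0))
      have h4 := base_le _ b (c (p 0))
      rw [ht.baseLetters_eq hv, le_length_lastLetters_take (by omega) (h4.trans ht.1.le)]
      omega
    | max =>
      refine ⟨0, fun G hG B _ f h H v m c d lo hi a hd =>
        ⟨_, .const (c (p 0) = none ∧ d (p 0) = 1), fun w t ht hv b x hx sep => ?_⟩⟩
      change (x (p 0) : ℕ) + 1 = w.length ↔ _
      have h1 := hd (p 0)
      have h2 := hx (p 0)
      have h3 := a.one_le (c (p 0))
      have h4 := ht.1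
      rcases e : c (p 0) with _ | j
      · rw [e] at h2
        simp only [base, Option.elim, true_and] at h2 ⊢
        omega
      · rw [e] at h2
        simp only [base, Option.elim, reduceCtorEq, false_and, iff_false] at h2 ⊢
        omega
    | empty =>
      refine ⟨0, fun G hG B _ f h H v m c d lo hi a hd =>
        ⟨_, .const (v = []), fun w t ht hv b x hx sep => ?_⟩⟩
      change w = [] ↔ _
      have := a.hi_lt none
      rw [← hv]
      simp [lastLetters]
      omega
  | imp _ _ ih₁ ih₂ =>
    obtain ⟨g₁, ih₁⟩ := ih₁
    obtain ⟨g₂, ih₂⟩ := ih₂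
    refine ⟨max g₁ g₂, fun G hG B _ f h H v m c d lo hi a hd => ?_⟩
    obtain ⟨R, hR, h₁⟩ := ih₁ G (by omega) B f h H v m c d lo hi a hd
    obtain ⟨S, hS, h₂⟩ := ih₂ G (by omega) B f h H v m c d lo hi a hd
    refine ⟨_, hR.imp hS, fun w t ht hv b x hx sep => ?_⟩
    rw [Language.BoundedFormula.realize_imp, h₁ w t ht hv b x hx sep, h₂ w t ht hv b x hx sep]
  | @all n k φ _ ih =>
    obtain ⟨g, ih⟩ := ih
    refine ⟨2 * g, fun G hG B _ f h H v m c d lo hi a hd => ?_⟩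
    -- the new position is in the extended territory of an old base position
    have near : ∀ q : {q : Option (Fin m) × Fin h // Near (G / 2) lo hi q.1 q.2}, _ := fun q =>
      ih (G / 2) (by omega) B f h H v m (Fin.snoc c q.1.1 : Fin (k + 1) → _)
        (Fin.snoc d (q.1.2 : ℕ) : Fin (k + 1) → _) _ _ (a.update q.2) (by
          refine Fin.lastCases ?_ fun i => ?_
          · simp
          · simp only [Fin.snoc_castSucc]
            have := hd i
            by_cases e : c i = q.1.1
            · rw [e] at this ⊢
              simp [this]
            · simpa [e] using this)
    choose R hR near using near
    -- the new position gets a base position of its own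
    obtain ⟨S, hS, new⟩ := ih (G / 2) (by omega) B f h H v (m + 1)
      (Fin.snoc (fun i => (c i).map Fin.castSucc) (some (Fin.last m)) : Fin (k + 1) → _)
      (Fin.snoc d H : Fin (k + 1) → _) _ _ a.extend (by
        refine Fin.lastCases ?_ fun i => ?_
        · simp
        · simpa using hd i)
    refine ⟨_, (LevelDefinable.forall_finite fun q => (orderSig_baseLetters
      (fun u => (q.1.2 : ℕ) ≤ u.length) v f q.1.1).imp (hR q)).and
      (LevelDefinable.imp (s := .pi) ((orderSig_letter (fun l => H ≤ (f l).length)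
        (Fin.last m)).and (LevelDefinable.forall_finite fun i =>
        orderSig_far (G / 2) H lo hi i)) hS).all, fun w t ht hv b x hx sep => ?_⟩
    rw [Language.BoundedFormula.realize_all]
    simp only [Fin.snoc_last, Fin.snoc_castSucc, ht.baseLetters_eq hv, ht.2]
    have hH : H ≤ h := ((a.le_hi none).trans (Nat.le_add_right _ G)).trans (a.hi_lt none).le
    have hnear : ∀ (y : Fin w.length) q, (y : ℕ) + q.1.2 = base t.length b q.1.1 →
        (φ.Realize default (Fin.snoc x y : Fin (k + 1) → _) ↔ R q t b) := by
      intro y q hy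
      refine near q w t ht hv b _ (Fin.lastCases ?_ fun i => ?_) (sep.update q.2)
      · simpa using hy
      · simpa using hx i
    have hnew : ∀ (y : Fin w.length) (z : Fin t.length), (y : ℕ) + H = z →
        (∀ i, Far (G / 2) H lo hi t.length b z i) →
        (φ.Realize default (Fin.snoc x y : Fin (k + 1) → _) ↔ S t (Fin.snoc b z)) := by
      intro y z hy hz
      refine new w t ht hv _ _ (Fin.lastCases ?_ fun i => ?_) (sep.extend a hz)
      · simpa [base_snoc_last] using hy
      · simpa [base_snoc_map] using hx i
    constructor
    · refine fun hall => ⟨fun q hq => ?_, fun z ⟨hz, hf⟩ => ?_⟩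
      · have hb := base_le _ b q.1.1
        rw [le_length_lastLetters_take q.1.2.2.le (hb.trans ht.1.le)] at hq
        have h1 := q.2.1
        have h2 := ht.1
        exact (hnear ⟨base t.length b q.1.1 - q.1.2, by omega⟩ q (by simp only; omega)).1 (hall _)
      · rw [le_length_lastLetters_take hH (z.2.le.trans ht.1.le)] at hz
        have h2 := ht.1
        exact (hnew ⟨z - H, by omega⟩ z (by simp only; omega) hf).1 (hall _)
    · rintro ⟨hn, hf⟩ y
      by_cases hy : ∃ i δ, (y : ℕ) + δ = base t.length b i ∧ Near (G / 2) lo hi i δ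
      · obtain ⟨i, δ, hy, hδ⟩ := hy
        have hlt : δ < h := by
          have := hδ.2.2
          have := a.hi_lt i
          omega
        refine (hnear y ⟨(i, ⟨δ, hlt⟩), hδ⟩ hy).2 (hn _ ?_)
        rw [le_length_lastLetters_take hlt.le ((base_le _ b i).trans ht.1.le)]
        omega
      · push Not at hy
        obtain ⟨hz, hfar⟩ := far_of_not_near a (y.2.trans_eq ht.1.symm) hy
        refine (hnew y ⟨y + H, hz⟩ rfl hfar).2 (hf _ ⟨?_, hfar⟩)
        rw [le_length_lastLetters_take hH (hz.le.trans ht.1.le)]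
        simp
  | lift _ ih =>
    obtain ⟨g, ih⟩ := ih
    refine ⟨g, fun G hG B _ f h H v m c d lo hi a hd => ?_⟩
    obtain ⟨R, hR, h⟩ := ih G hG B f h H v m c d lo hi a hd
    exact ⟨R, hR.lift, h⟩

/-- For sentences the only base position is the end of the word. It starts with the offsets
`1, …, G + 1` as its territory, so that all offsets stay below `2 * G + 2`. -/
theorem exists_sigma_order_sentence {φ : (succSig A).Sentence} (hφ : IsSigma n φ) :
    ∃ g, ∀ G, g ≤ G → ∀ (B : Type u) [Finite B] (f : B → List A) (v : List A),
      ∃ ψ : (orderSig B).Sentence, IsSigma n ψ ∧ ∀ (w : List A) (t : List B),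
        IsLastTagging (2 * G + 2) f w t → lastLetters (2 * G + 2) w = v →
        (Fin w.length ⊨ φ ↔ Fin t.length ⊨ ψ) := by
  obtain ⟨g, hg⟩ := exists_levelDefinable_base hφ
  refine ⟨g, fun G hG B _ f v => ?_⟩
  obtain ⟨R, ⟨ψ, hψ, hR⟩, h⟩ := hg G hG B f (2 * G + 2) (G + 1) v 0 Fin.elim0 Fin.elim0
    (fun _ => 1) (fun _ => G + 1)
    ⟨fun _ => le_rfl, fun _ => by omega, fun _ => le_rfl, fun _ => by omega, rfl,
      fun j => j.elim0, by omega⟩ (fun i => i.elim0)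
  refine ⟨ψ, hψ, fun w t ht hv => ?_⟩
  exact (h w t ht hv default default (fun i => i.elim0)
    (fun i j hij => absurd (Subsingleton.elim i j) hij)).trans (hR t default).symm

theorem exists_bSigma_order_sentence {φ : (succSig A).Sentence} (hφ : IsBSigma n φ) :
    ∃ g, ∀ G, g ≤ G → ∀ (B : Type u) [Finite B] (f : B → List A) (v : List A),
      ∃ ψ : (orderSig B).Sentence, IsBSigma n ψ ∧ ∀ (w : List A) (t : List B),
        IsLastTagging (2 * G + 2) f w t → lastLetters (2 * G + 2) w = v →
        (Fin w.length ⊨ φ ↔ Fin t.length ⊨ ψ) := by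
  induction hφ with
  | of hφ =>
    obtain ⟨g, hg⟩ := exists_sigma_order_sentence hφ
    refine ⟨g, fun G hG B _ f v => ?_⟩
    obtain ⟨ψ, hψ, h⟩ := hg G hG B f v
    exact ⟨ψ, .of hψ, h⟩
  | imp _ _ ih₁ ih₂ =>
    obtain ⟨g₁, ih₁⟩ := ih₁
    obtain ⟨g₂, ih₂⟩ := ih₂
    refine ⟨max g₁ g₂, fun G hG B _ f v => ?_⟩
    obtain ⟨ψ₁, hψ₁, h₁⟩ := ih₁ G (by omega) B f v
    obtain ⟨ψ₂, hψ₂, h₂⟩ := ih₂ G (by omega) B f v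
    exact ⟨ψ₁.imp ψ₂, .imp hψ₁ hψ₂, fun w t ht hv => imp_congr (h₁ w t ht hv) (h₂ w t ht hv)⟩

end Elimination

/-! ### The partition by last letters -/

section LastLettersPartition

variable {A : Type u}

/-- The class of `v` consists of the words that have the same suffixes of length at most
`h` as `v`. -/
theorem lastLetters_eq_iff {h : ℕ} {u v : List A} :
    lastLetters h u = lastLetters h v ↔
      ∀ x : {x : List A // x.length ≤ h}, x.1 <:+ u ↔ x.1 <:+ v := by
  have key : ∀ (x y : List A), x.length ≤ h → (x <:+ y ↔ x.reverse <+: lastLetters h y) := by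
    intro x y hx
    rw [lastLetters, List.prefix_take_iff, List.reverse_prefix, List.length_reverse]
    exact (and_iff_left hx).symm
  constructor
  · rintro e ⟨x, hx⟩
    rw [key _ _ hx, key _ _ hx, e]
  · intro H
    have aux : ∀ {u v : List A}, (∀ x : {x : List A // x.length ≤ h}, x.1 <:+ u → x.1 <:+ v) →
        lastLetters h u <+: lastLetters h v := by
      intro u v H
      have hl : (lastLetters h u).reverse.length ≤ h := by simp [lastLetters]
      have := H ⟨_, hl⟩ ((key _ _ hl).2 (by simp))
      simpa using (key _ _ hl).1 this
    have h1 := aux fun x => (H x).1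
    exact h1.eq_of_length_le (aux fun x => (H x).2).length_le

theorem iInter_mem_SU [Finite A] {ι : Type*} [Finite ι] {K : ι → Set (List A)}
    (h : ∀ i, K i ∈ SU A) : ⋂ i, K i ∈ SU A := by
  classical
  have := Fintype.ofFinite ι
  let S := BooleanSubalgebra.closure {K : Set (List A) | ∃ w : List A, K = {v | w <:+ v}}
  have : Finset.univ.inf K ∈ S := Finset.univ.inf_mem (S : Set (Set (List A)))
    BooleanSubalgebra.top_mem (fun _ hx _ hy => BooleanSubalgebra.inf_mem hx hy) K fun i _ => h i
  rw [Finset.inf_univ_eq_iInf] at this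
  exact this

theorem setOf_lastLetters_eq_mem_SU [Finite A] (h : ℕ) (v : List A) :
    {u | lastLetters h u = lastLetters h v} ∈ SU A := by
  have : Finite {x : List A // x.length ≤ h} := (List.finite_length_le A h).to_subtype
  have e : {u | lastLetters h u = lastLetters h v} =
      ⋂ x : {x : List A // x.length ≤ h}, {u | x.1 <:+ u ↔ x.1 <:+ v} := by
    ext u
    simp only [Set.mem_ofPred_eq, Set.mem_iInter]
    exact lastLetters_eq_iff
  rw [e]
  refine iInter_mem_SU fun x => ?_
  have hx : {u : List A | x.1 <:+ u} ∈ BooleanSubalgebra.closure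
      {K : Set (List A) | ∃ w : List A, K = {v | w <:+ v}} :=
    BooleanSubalgebra.subset_closure ⟨x.1, rfl⟩
  by_cases hv : x.1 <:+ v
  · simp only [hv, iff_true]
    exact hx
  · simp only [hv, iff_false]
    exact BooleanSubalgebra.compl_mem hx

/-- The partition into the classes of words with the same last `h` letters shows that a language
is in an enrichment by suffix languages. -/
theorem mem_enrichment_SU [Finite A] (C : LangClass.{u}) (h : ℕ) (L : Set (List A))
    (H : ∀ (B : Type u) [Finite B] (f : B → List A) (v : List A), ∃ K ∈ C B,
      ∀ (w : List A) (t : List B), IsLastTagging h f w t → lastLetters h w = v →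
        (w ∈ L ↔ t ∈ K)) :
    L ∈ enrichment C SU A := by
  let r : Setoid (List A) := Setoid.ker (lastLetters h)
  have hP : Setoid.IsPartition r.classes := Setoid.isPartition_classes r
  have hfin : Finite r.classes := by
    have : Finite {x : List A // x.length ≤ h} := (List.finite_length_le A h).to_subtype
    refine Set.Finite.subset (Set.finite_range fun x : {x : List A // x.length ≤ h} =>
      {u | lastLetters h u = x.1}) ?_
    rintro _ ⟨v, rfl⟩
    exact ⟨⟨lastLetters h v, by simp [lastLetters]⟩, rfl⟩
  -- the last letters of the words in a class
  have hrep : ∀ Q : r.classes, ∃ v, ∀ u ∈ Q.1, lastLetters h u = v := by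
    rintro ⟨_, v, rfl⟩
    exact ⟨lastLetters h v, fun u hu => hu⟩
  choose e he using hrep
  refine ⟨r.classes, hP, hfin, ?_, ?_⟩
  · rintro _ ⟨v, rfl⟩
    exact setOf_lastLetters_eq_mem_SU h v
  · choose K hK hKL using fun Q => H (r.classes × A) (fun q => e q.1) (e Q)
    refine ⟨K, hK, ?_⟩
    ext w
    have ht : IsLastTagging h (fun q : r.classes × A => e q.1) w (tagging hP w) := by
      refine ⟨length_tagging hP w, fun p => ?_⟩
      rw [get_tagging hP w ⟨p, p.2.trans_eq (length_tagging hP w)⟩ p rfl]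
      exact (he _ _ (mem_block hP _)).symm
    simp only [Set.mem_iUnion, Set.mem_inter_iff, Set.mem_preimage]
    constructor
    · intro hw
      have hb := mem_block hP w
      exact ⟨block hP w, hb, (hKL _ w _ ht (he _ _ hb)).1 hw⟩
    · rintro ⟨Q, hQ, hw⟩
      exact (hKL Q w _ ht (he _ _ hQ)).2 hw

end LastLettersPartition

/-! ### Languages in an enrichment -/

section Enrichment

variable {A : Type u} {n : ℕ}

theorem exists_sentence {s : Side} {p : List A → Prop}
    (h : LevelDefinable (succSig A) s n 0 fun w _ => p w) :
    ∃ φ : (succSig A).Sentence, IsLevel s n φ ∧ ∀ w, Fin w.length ⊨ φ ↔ p w := by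
  obtain ⟨φ, hφ, h⟩ := h
  exact ⟨φ, hφ, fun w => h w default⟩

/-- Closure of a class of sentences under implication gives its closure under finite
disjunctions. -/
theorem exists_bSigma_exists_and {ι : Type*} [Finite ι] {p q : ι → List A → Prop}
    (hp : ∀ i, ∃ φ : (succSig A).Sentence, IsBSigma n φ ∧ ∀ w, Fin w.length ⊨ φ ↔ p i w)
    (hq : ∀ i, ∃ φ : (succSig A).Sentence, IsBSigma n φ ∧ ∀ w, Fin w.length ⊨ φ ↔ q i w) :
    ∃ φ : (succSig A).Sentence, IsBSigma n φ ∧ ∀ w, Fin w.length ⊨ φ ↔ ∃ i, p i w ∧ q i w := by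
  classical
  have := Fintype.ofFinite ι
  suffices H : ∀ t : Finset ι, ∃ φ : (succSig A).Sentence, IsBSigma n φ ∧
      ∀ w : List A, Fin w.length ⊨ φ ↔ ∃ i ∈ t, p i w ∧ q i w by
    simpa using H Finset.univ
  intro t
  induction t using Finset.induction_on with
  | empty => exact ⟨.falsum, .of .falsum, fun w => ⟨False.elim, by simp⟩⟩
  | insert i t _ ih =>
    obtain ⟨φ, hφ, h⟩ := ih
    obtain ⟨ψ, hψ, h'⟩ := hp i
    obtain ⟨χ, hχ, h''⟩ := hq i
    refine ⟨(ψ.imp (χ.imp .falsum)).imp φ, .imp (.imp hψ (.imp hχ (.of .falsum))) hφ,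
      fun w => ?_⟩
    change ((Fin w.length ⊨ ψ → Fin w.length ⊨ χ → False) → Fin w.length ⊨ φ) ↔ _
    rw [h, h', h'', Finset.exists_mem_insert]
    tauto

variable [Finite A] {P : Set (Set (List A))}

theorem levelDefinable_sentence_tagging (hP : Setoid.IsPartition P) (hSU : ∀ Q ∈ P, Q ∈ SU A)
    {φ : (orderSig (P × A)).Sentence} (hφ : IsSigma (n + 1) φ) :
    LevelDefinable (succSig A) .sigma (n + 1) 0 fun (w : List A) _ =>
      Fin (tagging hP w).length ⊨ φ := by
  obtain ⟨R, hR, h⟩ := levelDefinable_tagging hP hSU hφ .sigma n (Or.inr ⟨rfl, rfl⟩)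
  refine hR.congr fun w x => ?_
  rw [Subsingleton.elim x default]
  exact (h w default default fun i => i.elim0).symm

theorem levelDefinable_mem_SU {K : Set (List A)} (hK : K ∈ SU A) (s : Side) :
    LevelDefinable (succSig A) s (n + 1) 0 fun (w : List A) _ => w ∈ K :=
  levelDefinable_of_mem_SU hK _ (fun u s => succSig_suffix u s n 0) s

theorem exists_bSigma_sentence_tagging (hP : Setoid.IsPartition P) (hSU : ∀ Q ∈ P, Q ∈ SU A)
    {φ : (orderSig (P × A)).Sentence} (hφ : IsBSigma (n + 1) φ) :
    ∃ ψ : (succSig A).Sentence, IsBSigma (n + 1) ψ ∧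
      ∀ w : List A, Fin w.length ⊨ ψ ↔ Fin (tagging hP w).length ⊨ φ := by
  induction hφ with
  | of hφ =>
    obtain ⟨ψ, hψ, h⟩ := exists_sentence (levelDefinable_sentence_tagging hP hSU hφ)
    exact ⟨ψ, .of hψ, h⟩
  | imp _ _ ih₁ ih₂ =>
    obtain ⟨ψ₁, hψ₁, h₁⟩ := ih₁
    obtain ⟨ψ₂, hψ₂, h₂⟩ := ih₂
    exact ⟨ψ₁.imp ψ₂, .imp hψ₁ hψ₂, fun w => imp_congr (h₁ w) (h₂ w)⟩

end Enrichment

end WordLogic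

theorem proposition6p2 (n : ℕ) (hn : 1 ≤ n) :
    WordLogic.SigmaSucc.{u} n =
        WordLogic.enrichment (WordLogic.SigmaOrder.{u} n) WordLogic.SU.{u} ∧
      WordLogic.BSigmaSucc.{u} n =
        WordLogic.enrichment (WordLogic.BSigmaOrder.{u} n) WordLogic.SU.{u} := by
  obtain ⟨n, rfl⟩ : ∃ m, n = m + 1 := ⟨n - 1, by omega⟩
  constructor
  · funext A _
    refine Set.Subset.antisymm ?_ ?_
    · rintro _ ⟨φ, hφ, rfl⟩
      obtain ⟨g, hg⟩ := WordLogic.exists_sigma_order_sentence hφ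
      refine WordLogic.mem_enrichment_SU _ (2 * g + 2) _ fun B _ f v => ?_
      obtain ⟨ψ, hψ, h⟩ := hg g le_rfl B f v
      exact ⟨_, ⟨ψ, hψ, rfl⟩, h⟩
    · rintro _ ⟨P, hP, _, hSU, K, hK, rfl⟩
      choose φ hφ hφK using hK
      obtain ⟨ψ, hψ, h⟩ := WordLogic.exists_sentence <| WordLogic.LevelDefinable.exists_finite
        fun Q : P => (WordLogic.levelDefinable_mem_SU (hSU Q Q.2) .sigma).and
          (WordLogic.levelDefinable_sentence_tagging hP hSU (hφ Q))
      refine ⟨ψ, hψ, ?_⟩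
      ext w
      simp [h, hφK]
  · funext A _
    refine Set.Subset.antisymm ?_ ?_
    · rintro _ ⟨φ, hφ, rfl⟩
      obtain ⟨g, hg⟩ := WordLogic.exists_bSigma_order_sentence hφ
      refine WordLogic.mem_enrichment_SU _ (2 * g + 2) _ fun B _ f v => ?_
      obtain ⟨ψ, hψ, h⟩ := hg g le_rfl B f v
      exact ⟨_, ⟨ψ, hψ, rfl⟩, h⟩
    · rintro _ ⟨P, hP, _, hSU, K, hK, rfl⟩
      choose φ hφ hφK using hK
      obtain ⟨ψ, hψ, h⟩ := WordLogic.exists_bSigma_exists_and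
        (fun Q : P => (WordLogic.exists_sentence
          (WordLogic.levelDefinable_mem_SU (n := n) (hSU Q Q.2) .sigma)).imp
            fun _ h => ⟨.of h.1, h.2⟩)
        (fun Q : P => WordLogic.exists_bSigma_sentence_tagging hP hSU (hφ Q))
      refine ⟨ψ, hψ, ?_⟩
      ext w
      simp [h, hφK]
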